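/- All rings are associative and unital. A multiplicative set $S$ of a ring $R$ is a subset with $1\in S$, $SS\subseteq S$ and $0\notin S$. Let $R\langle S^{-1}\rangle$ be the ring freely generated by $R$ and noncommuting indeterminates $x_s$ ($s\in S$), modulo the relations $sx_s=1=x_ss$ ($s\in S$), and let $\mathrm{ass}_R(S)$ be the kernel of the canonical map $R\to R\langle S^{-1}\rangle$. Call $S$ left (resp. right) localizable if $R\langle S^{-1}\rangle\neq 0$ and every element of $R\langle S^{-1}\rangle$ has the form $s^{-1}r$ (resp. $rs^{-1}$), where $s\in S$, $r\in R$, and $r$, $s$ also denote their images. Let $\mathbb L_l(R)$ and $\mathbb L_r(R)$ be the sets of left, respectively right, localizable sets of $R$, and $\mathbb L_\emptyset(R)=\mathbb L_l(R)\cap\mathbb L_r(R)$. For a ring $A$, let $\mathcal C_A$ be the set of its regular elements (those that are neither left nor right zero divisors), $Q_{l,cl}(A)=\mathcal C_A^{-1}A$ its classical left quotient ring and $Q_{r,cl}(A)=A\mathcal C_A^{-1}$ its classical right quotient ring, when they exist; $Q_{\emptyset,cl}(A)=\mathcal C_A^{-1}A\simeq A\mathcal C_A^{-1}$ when both exist.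 The ring $A$ is left Goldie if it has finite left uniform dimension and satisfies the ascending chain condition on left annihilators; right Goldie rings are defined symmetrically, and "$\emptyset$ Goldie" means left and right Goldie. For an ideal $\mathfrak p$ of $R$ put $\mathcal C(\mathfrak p)=\{c\in R : c+\mathfrak p\in\mathcal C_{R/\mathfrak p}\}$, and let $\min(R)$ be the set of minimal prime ideals of $R$. An $R$-isomorphism is a ring isomorphism that commutes with the canonical maps from $R$. **Theorem.** Let $*\in\{l,r,\emptyset\}$, let $R$ be a ring, let $S_1,\dots,S_n\in\mathbb L_*(R)$, and put $\mathfrak p_i=\mathrm{ass}_R(S_i)$, $R_i=R/\mathfrak p_i$ and $Q_i=R\langle S_i^{-1}\rangle$. Suppose that every $Q_i$ is a simple Artinian ring, that $\bigcap_{i=1}^n\mathfrak p_i=0$, and that $\bigcap_{j\ne i}\mathfrak p_j\neq 0$ for $i=1,\dots,n$. (For $n=1$ the empty intersection is $R$.) Then: 1. every $R_i$ is a prime $*$ Goldie ring; 2. $\min(R)=\{\mathfrak p_1,\dots,\mathfrak p_n\}$; 3. for every $i$, the ring $Q_{*,cl}(R_i)$ exists and $Q_i\simeq Q_{*,cl}(R_i)$,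 an $R$-isomorphism; 4. $S_i\subseteq\mathcal C(\mathfrak p_i)$ for every $i$; 5. the ring $Q_{*,cl}(R)$ exists and $Q_{*,cl}(R)\simeq\prod_{i=1}^n Q_i$, an $R$-isomorphism; 6. for every $i$, $\mathcal C(\mathfrak p_i)$ is a maximal element, with respect to inclusion, of $\mathbb L_*(R)$. -/

import Mathlib

universe u v

namespace LocalizableSets

/-! ### The ring `R⟨S⁻¹⟩` -/

/-- The relations among the generators `[r]` (`r ∈ R`) and `x` (`x ∈ X`) saying that `r ↦ [r]`
is a ring homomorphism. -/
inductive FreeRel (R : Type u) [Ring R] (X : Type v) :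
    FreeAlgebra ℤ (R ⊕ X) → FreeAlgebra ℤ (R ⊕ X) → Prop
  | one : FreeRel R X (FreeAlgebra.ι ℤ (Sum.inl 1)) 1
  | add (a b : R) : FreeRel R X (FreeAlgebra.ι ℤ (Sum.inl (a + b)))
      (FreeAlgebra.ι ℤ (Sum.inl a) + FreeAlgebra.ι ℤ (Sum.inl b))
  | mul (a b : R) : FreeRel R X (FreeAlgebra.ι ℤ (Sum.inl (a * b)))
      (FreeAlgebra.ι ℤ (Sum.inl a) * FreeAlgebra.ι ℤ (Sum.inl b))

/-- The ring `R⟨X⟩` freely generated by the ring `R` and the set `X` of noncommuting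
indeterminates (which do not commute with the elements of `R` either). -/
abbrev FreeOver (R : Type u) [Ring R] (X : Type v) := RingQuot (FreeRel R X)

/-- The canonical ring homomorphism `R → R⟨X⟩`. -/
noncomputable def FreeOver.of (R : Type u) [Ring R] (X : Type v) : R →+* FreeOver R X where
  toFun r := RingQuot.mkRingHom (FreeRel R X) (FreeAlgebra.ι ℤ (Sum.inl r))
  map_one' := by rw [RingQuot.mkRingHom_rel FreeRel.one, map_one]
  map_mul' a b := by rw [RingQuot.mkRingHom_rel (FreeRel.mul a b), map_mul]
  map_add' a b := by rw [RingQuot.mkRingHom_rel (FreeRel.add a b), map_add]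
  map_zero' := by
    have h := RingQuot.mkRingHom_rel (FreeRel.add (R := R) (X := X) 0 0)
    rw [map_add, add_zero] at h
    exact left_eq_add.mp h

/-- The indeterminate of `R⟨X⟩` indexed by `x ∈ X`. -/
noncomputable def FreeOver.var (R : Type u) [Ring R] {X : Type v} (x : X) : FreeOver R X :=
  RingQuot.mkRingHom (FreeRel R X) (FreeAlgebra.ι ℤ (Sum.inr x))

section

variable {R : Type u} [Ring R]

/-- The relations `s * x_s = 1` and `x_s * s = 1`, for `s ∈ S`. -/
inductive InvRel (S : Submonoid R) : FreeOver R S → FreeOver R S → Prop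
  | mul_inv (s : S) : InvRel S (FreeOver.of R S s * FreeOver.var R s) 1
  | inv_mul (s : S) : InvRel S (FreeOver.var R s * FreeOver.of R S s) 1

/-- The ring `R⟨S⁻¹⟩ = R⟨X_S⟩ / (s x_s - 1, x_s s - 1 | s ∈ S)`. -/
abbrev Loc (S : Submonoid R) := RingQuot (InvRel S)

/-- The canonical ring homomorphism `R → R⟨S⁻¹⟩`. -/
noncomputable def toLoc (S : Submonoid R) : R →+* Loc S :=
  (RingQuot.mkRingHom (InvRel S)).comp (FreeOver.of R S)

/-- The inverse in `R⟨S⁻¹⟩` of the image of `s ∈ S`, i.e. the class of `x_s`. -/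
noncomputable def locInv (S : Submonoid R) (s : S) : Loc S :=
  RingQuot.mkRingHom (InvRel S) (FreeOver.var R s)

/-- `ass_R(S)`, the kernel of `R → R⟨S⁻¹⟩`. -/
noncomputable def ass (S : Submonoid R) : TwoSidedIdeal R := TwoSidedIdeal.ker (toLoc S)

/-- The ring homomorphism `R / ass_R(S) → R⟨S⁻¹⟩` induced by `R → R⟨S⁻¹⟩`. -/
noncomputable def assQuotToLoc (S : Submonoid R) : (ass S).ringCon.Quotient →+* Loc S :=
  (ass S).ringCon.lift (toLoc S) fun _ _ h => h

/-- `S` is a left localizable set: a multiplicative set (`1 ∈ S`, `SS ⊆ S`, `0 ∉ S`) such that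
`R⟨S⁻¹⟩` is nonzero and consists of left fractions `s⁻¹ r`. -/
structure IsLeftLocalizable (S : Submonoid R) : Prop where
  zero_notMem : (0 : R) ∉ S
  nontrivial : Nontrivial (Loc S)
  exists_fraction : ∀ q : Loc S, ∃ (s : S) (r : R), q = locInv S s * toLoc S r

/-- `S` is a right localizable set: a multiplicative set (`1 ∈ S`, `SS ⊆ S`, `0 ∉ S`) such that
`R⟨S⁻¹⟩` is nonzero and consists of right fractions `r s⁻¹`. -/
structure IsRightLocalizable (S : Submonoid R) : Prop where
  zero_notMem : (0 : R) ∉ S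
  nontrivial : Nontrivial (Loc S)
  exists_fraction : ∀ q : Loc S, ∃ (r : R) (s : S), q = toLoc S r * locInv S s

end

/-- The three settings "left", "right" and "left and right". -/
inductive Side
  | left
  | right
  | both

/-- `S ∈ 𝕃_*(R)` for `* ∈ {l, r, ∅}`. -/
def IsLocalizable {R : Type u} [Ring R] : Side → Submonoid R → Prop
  | .left, S => IsLeftLocalizable S
  | .right, S => IsRightLocalizable S
  | .both, S => IsLeftLocalizable S ∧ IsRightLocalizable S

/-! ### Prime ideals -/

/-- `P` is a prime ideal of the (noncommutative) ring `R`: it is proper, and `I J ⊆ P` implies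
`I ⊆ P` or `J ⊆ P` for all ideals `I`, `J` of `R`. -/
def IsPrimeIdeal {R : Type u} [Ring R] (P : TwoSidedIdeal R) : Prop :=
  P ≠ ⊤ ∧ ∀ I J : TwoSidedIdeal R, (∀ a ∈ I, ∀ b ∈ J, a * b ∈ P) → I ≤ P ∨ J ≤ P

/-- `min(R)`, the set of minimal prime ideals of `R`. -/
def minPrimes (R : Type u) [Ring R] : Set (TwoSidedIdeal R) := {P | Minimal IsPrimeIdeal P}

/-- `A` is a prime ring. -/
def IsPrimeRing (A : Type u) [Ring A] : Prop := IsPrimeIdeal (⊥ : TwoSidedIdeal A)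

/-! ### Goldie rings -/

/-- The left uniform dimension of `A`: the supremum of the `k` such that `A` contains a direct sum
of `k` nonzero left ideals. -/
noncomputable def leftUniformDim (A : Type u) [Ring A] : ℕ∞ :=
  ⨆ (k : ℕ) (_ : ∃ I : Fin k → Ideal A, iSupIndep I ∧ ∀ i, I i ≠ ⊥), (k : ℕ∞)

/-- The left annihilator `{a ∈ A | a X = 0}` of a subset `X` of `A`. -/
def leftAnn {A : Type u} [Ring A] (X : Set A) : Set A := {a | ∀ x ∈ X, a * x = 0}

/-- `A` is a left Goldie ring: it has finite left uniform dimension and satisfies the ascending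
chain condition on left annihilators. -/
def IsLeftGoldie (A : Type u) [Ring A] : Prop :=
  leftUniformDim A < ⊤ ∧
    ∀ X : ℕ → Set A, Monotone (fun n => leftAnn (X n)) →
      ∃ n, ∀ m, n ≤ m → leftAnn (X m) = leftAnn (X n)

/-- `A` is a `*` Goldie ring for `* ∈ {l, r, ∅}`. -/
def IsGoldie : Side → ∀ (A : Type u) [Ring A], Prop
  | .left, A, _ => IsLeftGoldie A
  | .right, A, _ => IsLeftGoldie Aᵐᵒᵖ
  | .both, A, _ => IsLeftGoldie A ∧ IsLeftGoldie Aᵐᵒᵖ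

/-! ### Classical quotient rings

`nonZeroDivisors A` is the set of regular elements of `A`, and Mathlib's `OreLocalization` is the
ring of left fractions; `OreLocalization.OreSet` holds the data of a left denominator set. -/

/-- The classical left quotient ring `Q_{l,cl}(A)` of `A` exists, i.e. the set of regular elements
is a left denominator set, and there is a ring isomorphism `Q_{l,cl}(A) ≃ Q` that
carries the canonical map `A → Q_{l,cl}(A)` to `f : A → Q`. -/
def IsLeftClassicalQuotient {A : Type u} [Ring A] {Q : Type v} [Ring Q] (f : A →+* Q) : Prop :=
  ∃ _ : OreLocalization.OreSet (nonZeroDivisors A),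
    ∃ e : OreLocalization (nonZeroDivisors A) A ≃+* Q,
      ∀ a : A, e (OreLocalization.numeratorRingHom a) = f a

/-- The same for the classical right quotient ring, which is the opposite ring of the classical
left quotient ring of the opposite ring. -/
def IsRightClassicalQuotient {A : Type u} [Ring A] {Q : Type v} [Ring Q] (f : A →+* Q) : Prop :=
  IsLeftClassicalQuotient (RingHom.op f)

/-- `Q`, via `f : A → Q`, is the classical `*` quotient ring of `A`, for `* ∈ {l, r, ∅}`. -/
def IsClassicalQuotient (side : Side) (A : Type u) [Ring A] (Q : Type v) [Ring Q]
    (f : A →+* Q) : Prop :=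
  match side with
  | .left => IsLeftClassicalQuotient f
  | .right => IsRightClassicalQuotient f
  | .both => IsLeftClassicalQuotient f ∧ IsRightClassicalQuotient f

/-- `𝒞(P)`, the set of elements of `R` whose class is a regular element of `R / P`. -/
def regularModulo {R : Type u} [Ring R] (P : TwoSidedIdeal R) : Submonoid R :=
  (nonZeroDivisors P.ringCon.Quotient).comap P.ringCon.mk'

end LocalizableSets

/-!
Everything is read off from the ring homomorphism `f : R → R⟨S⁻¹⟩`, of which one remembers only that
each element of the target is a fraction of elements of `R`. If the target is left Artinian, right
multiplication by a denominator `f s` maps the left ideal `L` generated by the image of an ideal `I`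
injectively into itself, hence onto itself, so `L` is a two-sided ideal. If the target is moreover
simple and `f I ≠ 0`, then `1 ∈ L` is a fraction with numerator in `I`: the ideal `I` contains an
element that becomes invertible. Hence the kernel of `f` is prime. For the whole family, the
irredundance of `⋂ 𝔭ᵢ = 0` yields elements `dᵢ ∈ ⋂_{j ≠ i} 𝔭ⱼ` that become invertible in `Qᵢ`, and
`∑ dᵢ sᵢ` is then a common denominator of any family of fractions with denominators `sᵢ`. Maximality
of `𝒞(𝔭ᵢ)` holds because a simple ring `Qᵢ` embeds into every further localization.
-/

namespace LocalizableSets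

/-! ### The universal property of `R⟨S⁻¹⟩` -/

namespace FreeOver

variable {R : Type*} [Ring R] {X : Type*} {T : Type*} [Ring T]

/-- The universal property of `R⟨X⟩`: the ring homomorphism `R⟨X⟩ → T` that extends `f : R → T` and
sends the indeterminates to prescribed elements. -/
noncomputable def lift (f : R →+* T) (g : X → T) : FreeOver R X →+* T :=
  RingQuot.lift ⟨(FreeAlgebra.lift ℤ (Sum.elim f g)).toRingHom, by rintro _ _ (_ | _ | _) <;> simp⟩

@[simp]
theorem lift_of (f : R →+* T) (g : X → T) (r : R) : lift f g (of R X r) = f r :=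
  (RingQuot.lift_mkRingHom_apply _ _ _).trans (FreeAlgebra.lift_ι_apply (R := ℤ) _ (Sum.inl r))

@[simp]
theorem lift_var (f : R →+* T) (g : X → T) (x : X) : lift f g (var R x) = g x :=
  (RingQuot.lift_mkRingHom_apply _ _ _).trans (FreeAlgebra.lift_ι_apply (R := ℤ) _ (Sum.inr x))

theorem ringHom_ext {F G : FreeOver R X →+* T} (hof : ∀ r, F (of R X r) = G (of R X r))
    (hvar : ∀ x, F (var R x) = G (var R x)) : F = G := by
  have h : (F.comp (RingQuot.mkRingHom (FreeRel R X))).toIntAlgHom =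
      (G.comp (RingQuot.mkRingHom (FreeRel R X))).toIntAlgHom :=
    FreeAlgebra.hom_ext (funext (Sum.rec hof hvar))
  exact RingQuot.ringQuot_ext _ _ (RingHom.ext fun z =>
    congrArg (fun φ : FreeAlgebra ℤ (R ⊕ X) →ₐ[ℤ] T => φ z) h)

end FreeOver

section Localization

variable {R : Type*} [Ring R] {S : Submonoid R}

theorem toLoc_mul_locInv (s : S) : toLoc S s * locInv S s = 1 := by
  have h := RingQuot.mkRingHom_rel (InvRel.mul_inv s)
  rwa [map_mul, map_one] at h

theorem locInv_mul_toLoc (s : S) : locInv S s * toLoc S s = 1 := by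
  have h := RingQuot.mkRingHom_rel (InvRel.inv_mul s)
  rwa [map_mul, map_one] at h

theorem isUnit_toLoc {s : R} (hs : s ∈ S) : IsUnit (toLoc S s) :=
  ⟨⟨_, _, toLoc_mul_locInv ⟨s, hs⟩, locInv_mul_toLoc ⟨s, hs⟩⟩, rfl⟩

namespace Loc

variable {T : Type*} [Ring T]

/-- The universal property of `R⟨S⁻¹⟩`: a ring homomorphism `f : R → T` that inverts `S` extends to
`R⟨S⁻¹⟩`. -/
noncomputable def lift (f : R →+* T) (hf : ∀ s ∈ S, IsUnit (f s)) : Loc S →+* T :=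
  RingQuot.lift ⟨FreeOver.lift f fun s : S => ↑(hf s s.2).unit⁻¹, by rintro _ _ (_ | _) <;> simp⟩

@[simp]
theorem lift_toLoc (f : R →+* T) (hf : ∀ s ∈ S, IsUnit (f s)) (r : R) :
    lift f hf (toLoc S r) = f r :=
  (RingQuot.lift_mkRingHom_apply _ _ _).trans (FreeOver.lift_of f _ r)

theorem ringHom_ext {F G : Loc S →+* T} (h : ∀ r, F (toLoc S r) = G (toLoc S r)) : F = G := by
  refine RingQuot.ringQuot_ext _ _ (FreeOver.ringHom_ext h fun s => ?_)
  have hF : F (locInv S s) * F (toLoc S s) = 1 := by rw [← map_mul, locInv_mul_toLoc, map_one]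
  have hG : F (toLoc S s) * G (locInv S s) = 1 := by
    rw [h, ← map_mul, toLoc_mul_locInv, map_one]
  exact left_inv_eq_right_inv hF hG

end Loc

/-- The set of all elements of `R` that become invertible in `R⟨S⁻¹⟩`. It is the largest submonoid
containing `S` with the same localization as `S`. -/
noncomputable def saturation (S : Submonoid R) : Submonoid R :=
  (IsUnit.submonoid (Loc S)).comap (toLoc S)

theorem mem_saturation {r : R} : r ∈ saturation S ↔ IsUnit (toLoc S r) := Iff.rfl

theorem le_saturation : S ≤ saturation S := fun _ => isUnit_toLoc

/-- The canonical isomorphism between the localizations at `S` and at its saturation. -/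
noncomputable def locEquivSaturation (S : Submonoid R) : Loc S ≃+* Loc (saturation S) :=
  RingEquiv.ofRingHom
    (Loc.lift (T := Loc (saturation S)) (toLoc _) fun _ hs => isUnit_toLoc (le_saturation hs))
    (Loc.lift (T := Loc S) (toLoc S) fun _ => mem_saturation.1)
    (Loc.ringHom_ext (T := Loc (saturation S)) fun r => by simp)
    (Loc.ringHom_ext (T := Loc S) fun r => by simp)

theorem locEquivSaturation_toLoc (r : R) :
    locEquivSaturation S (toLoc S r) = toLoc (saturation S) r :=
  Loc.lift_toLoc (T := Loc (saturation S)) _ _ r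

theorem isUnit_of_isUnit_map {Q T : Type*} [Ring Q] [IsSimpleRing Q] [IsArtinianRing Q]
    [Semiring T] [Nontrivial T] (F : Q →+* T) {q : Q} (hq : IsUnit (F q)) : IsUnit q :=
  IsArtinianRing.isUnit_of_mem_nonZeroDivisors
    (mem_nonZeroDivisors_of_injective F.injective hq.mem_nonZeroDivisors)

theorem le_saturation_of_le [IsSimpleRing (Loc S)] [IsArtinianRing (Loc S)] {T : Submonoid R}
    [Nontrivial (Loc T)] (hST : S ≤ T) : T ≤ saturation S := by
  intro t ht
  let F : Loc S →+* Loc T := Loc.lift (T := Loc T) (toLoc T) fun s hs => isUnit_toLoc (hST hs)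
  have hFt : IsUnit (F (toLoc S t)) := by
    rw [Loc.lift_toLoc]
    exact isUnit_toLoc ht
  exact isUnit_of_isUnit_map (Q := Loc S) F hFt

theorem assQuotToLoc_injective : Function.Injective (assQuotToLoc S) := by
  intro x y h
  obtain ⟨x, rfl⟩ := (ass S).ringCon.mk'_surjective x
  obtain ⟨y, rfl⟩ := (ass S).ringCon.mk'_surjective y
  exact Quotient.sound h

end Localization

/-! ### Rings of left fractions -/

/-- Every element of `Q` is a left fraction `f(s)⁻¹ f(r)`. The denominator `s` may be any element
that `f` inverts. -/
def HasLeftFractions {R Q : Type*} [Semiring R] [Semiring Q] (f : R →+* Q) : Prop :=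
  ∀ q : Q, ∃ s r : R, IsUnit (f s) ∧ f s * q = f r

namespace HasLeftFractions

section Semiring

variable {R Q : Type*} [Semiring R] [Semiring Q] {f : R →+* Q}

theorem of_comp {A : Type*} [Semiring A] {g : A →+* Q} {h : R →+* A}
    (hgh : HasLeftFractions (g.comp h)) : HasLeftFractions g := fun q => by
  obtain ⟨s, r, hs, hq⟩ := hgh q
  exact ⟨h s, h r, hs, hq⟩

theorem ringEquiv_comp (hf : HasLeftFractions f) {Q' : Type*} [Semiring Q'] (e : Q ≃+* Q') :
    HasLeftFractions ((e : Q →+* Q').comp f) := fun q => by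
  obtain ⟨s, r, hs, hq⟩ := hf (e.symm q)
  exact ⟨s, r, hs.map e, by simpa using congrArg e hq⟩

theorem exists_mul_eq_mul (hf : HasLeftFractions f) (r : R) {s : R} (hs : IsUnit (f s)) :
    ∃ u v : R, IsUnit (f u) ∧ f (u * r) = f (v * s) := by
  obtain ⟨c, hc⟩ := hs
  obtain ⟨u, v, hu, huv⟩ := hf (f r * ↑c⁻¹)
  refine ⟨u, v, hu, ?_⟩
  rw [map_mul, map_mul, ← huv, ← hc, mul_assoc, mul_assoc, Units.inv_mul, mul_one]

theorem exists_mul_eq_of_mem_map (hf : HasLeftFractions f) {I : Ideal R} {q : Q}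
    (hq : q ∈ I.map f) : ∃ s, ∃ a ∈ I, IsUnit (f s) ∧ f s * q = f a := by
  induction hq using Submodule.span_induction with
  | mem x hx =>
    obtain ⟨a, ha, rfl⟩ := hx
    exact ⟨1, a, ha, by simp, by simp⟩
  | zero => exact ⟨1, 0, I.zero_mem, by simp, by simp⟩
  | add x y _ _ hx hy =>
    obtain ⟨s, a, ha, hs, hx⟩ := hx
    obtain ⟨t, b, hb, ht, hy⟩ := hy
    obtain ⟨u, v, hu, huv⟩ := hf.exists_mul_eq_mul s ht
    refine ⟨u * s, u * a + v * b, I.add_mem (I.mul_mem_left _ ha) (I.mul_mem_left _ hb),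
      by simpa using hu.mul hs, ?_⟩
    calc f (u * s) * (x + y) = f u * (f s * x) + f (u * s) * y := by
          rw [mul_add, map_mul, mul_assoc]
      _ = f u * (f s * x) + f v * (f t * y) := by rw [huv, map_mul f v t, mul_assoc]
      _ = f (u * a + v * b) := by rw [hx, hy, map_add, map_mul, map_mul]
  | smul p x _ hx =>
    obtain ⟨s, a, ha, hs, hx⟩ := hx
    obtain ⟨t, r, ht, hr⟩ := hf p
    obtain ⟨u, v, hu, huv⟩ := hf.exists_mul_eq_mul r hs
    refine ⟨u * t, v * a, I.mul_mem_left _ ha, by simpa using hu.mul ht, ?_⟩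
    calc f (u * t) * (p * x) = f u * (f t * p) * x := by simp only [map_mul, mul_assoc]
      _ = f v * (f s * x) := by rw [hr, ← map_mul, huv, map_mul, mul_assoc]
      _ = f (v * a) := by rw [hx, map_mul]

end Semiring

theorem isUnit_map_iff_mem_nonZeroDivisors {R Q : Type*} [Ring R] [Ring Q] [IsArtinianRing Q]
    {f : R →+* Q} (hf : HasLeftFractions f) (hinj : Function.Injective f) {c : R} :
    IsUnit (f c) ↔ c ∈ nonZeroDivisors R := by
  refine ⟨fun hc => mem_nonZeroDivisors_of_injective hinj hc.mem_nonZeroDivisors, fun hc => ?_⟩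
  rw [IsArtinianRing.isUnit_iff_isRightRegular, isRightRegular_iff_left_eq_zero_of_mul]
  intro q hq
  obtain ⟨s, r, hs, hr⟩ := hf q
  have hrc : f (r * c) = 0 := by rw [map_mul, ← hr, mul_assoc, hq, mul_zero]
  have hr0 : r = 0 := hc.2 r ((map_eq_zero_iff f hinj).1 hrc)
  rw [hr0, map_zero] at hr
  exact hs.mul_right_eq_zero.1 hr

end HasLeftFractions

section TwoSidedIdeals

variable {R Q : Type*} [Ring R] [Ring Q]

theorem mul_map_mem_map_asIdeal (f : R →+* Q) (I : TwoSidedIdeal R) {q : Q}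
    (hq : q ∈ I.asIdeal.map f) (r : R) : q * f r ∈ I.asIdeal.map f := by
  have hle : I.asIdeal.map f ≤
      Submodule.comap (LinearMap.toSpanSingleton Q Q (f r)) (I.asIdeal.map f) := by
    refine Submodule.span_le.2 ?_
    rintro _ ⟨a, ha, rfl⟩
    have har : a * r ∈ I.asIdeal :=
      TwoSidedIdeal.mem_asIdeal.2 (I.mul_mem_right _ _ (TwoSidedIdeal.mem_asIdeal.1 ha))
    simpa using Ideal.mem_map_of_mem f har
  exact hle hq

theorem mul_inv_mem_of_forall_mul_mem {L : Ideal Q} [IsArtinian Q L] {u : Qˣ}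
    (hu : ∀ x ∈ L, x * u ∈ L) {x : Q} (hx : x ∈ L) : x * ↑u⁻¹ ∈ L := by
  let ρ : L →ₗ[Q] L := (LinearMap.toSpanSingleton Q Q (u : Q)).restrict hu
  have hρ : Function.Injective ρ := fun y z h =>
    Subtype.ext (u.isUnit.mul_left_injective (congrArg Subtype.val h))
  obtain ⟨y, hy⟩ := IsArtinian.surjective_of_injective_endomorphism ρ hρ ⟨x, hx⟩
  have hyx : (y : Q) * u = x := congrArg Subtype.val hy
  rw [← hyx, Units.mul_inv_cancel_right]
  exact y.2

theorem HasLeftFractions.mul_mem_map_asIdeal [IsArtinianRing Q] {f : R →+* Q}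
    (hf : HasLeftFractions f) (I : TwoSidedIdeal R) {q : Q} (hq : q ∈ I.asIdeal.map f) (w : Q) :
    q * w ∈ I.asIdeal.map f := by
  obtain ⟨s, r, ⟨u, hu⟩, hw⟩ := hf w
  have hw' : w = ↑u⁻¹ * f r := by rw [← hw, ← hu, Units.inv_mul_cancel_left]
  have hstable : ∀ x ∈ I.asIdeal.map f, x * u ∈ I.asIdeal.map f := fun x hx =>
    hu ▸ mul_map_mem_map_asIdeal f I hx s
  rw [hw', ← mul_assoc]
  exact mul_map_mem_map_asIdeal f I (mul_inv_mem_of_forall_mul_mem hstable hq) r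

theorem HasLeftFractions.exists_mem_isUnit_map [IsArtinianRing Q] [IsSimpleRing Q] {f : R →+* Q}
    (hf : HasLeftFractions f) {I : TwoSidedIdeal R} (hI : ¬ I ≤ TwoSidedIdeal.ker f) :
    ∃ d ∈ I, IsUnit (f d) := by
  obtain ⟨x, hx, hx0⟩ := Set.not_subset.1 hI
  let J : TwoSidedIdeal Q := TwoSidedIdeal.mk' (I.asIdeal.map f : Set Q) (Submodule.zero_mem _)
    (Submodule.add_mem _) (Submodule.neg_mem _) (fun h => Ideal.mul_mem_left _ _ h)
    (fun h => hf.mul_mem_map_asIdeal I h _)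
  have hJ : ∀ {q}, q ∈ J ↔ q ∈ I.asIdeal.map f := TwoSidedIdeal.mem_mk' ..
  have hxJ : f x ∈ J := hJ.2 (Ideal.mem_map_of_mem f (TwoSidedIdeal.mem_asIdeal.2 hx))
  have hJtop : J = ⊤ := (eq_bot_or_eq_top J).resolve_left fun hbot =>
    hx0 ((TwoSidedIdeal.mem_ker f).2 ((TwoSidedIdeal.mem_bot Q).1 (hbot ▸ hxJ)))
  obtain ⟨s, d, hd, hs, hsd⟩ :=
    hf.exists_mul_eq_of_mem_map (hJ.1 (J.one_mem_iff.2 hJtop))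
  exact ⟨d, TwoSidedIdeal.mem_asIdeal.1 hd, by rwa [← hsd, mul_one]⟩

end TwoSidedIdeals

/-! ### Classical quotient rings -/

section ClassicalQuotient

open OreLocalization

theorem universalHom_bijective {A Q : Type*} [Ring A] [Ring Q] {T : Submonoid A} [OreSet T]
    {f : A →+* Q} {g : T →* Qˣ} (hg : ∀ s : T, f s = g s) (hinj : Function.Injective f)
    (hfrac : ∀ q : Q, ∃ (s : T) (r : A), f s * q = f r) :
    Function.Bijective (universalHom f g hg) := by
  constructor
  · rw [injective_iff_map_eq_zero]
    intro x hx
    induction x using OreLocalization.ind with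
    | _ r s =>
    rw [universalHom_apply, Units.mul_right_eq_zero, map_eq_zero_iff f hinj] at hx
    rw [hx, zero_oreDiv]
  · intro q
    obtain ⟨s, r, hr⟩ := hfrac q
    refine ⟨r /ₒ s, ?_⟩
    rw [universalHom_apply, Units.inv_mul_eq_iff_eq_mul, ← hg, hr]

variable {A : Type u} {Q : Type v} [Ring A] [Ring Q] [IsArtinianRing Q] {f : A →+* Q}

theorem HasLeftFractions.nonempty_oreSet (hf : HasLeftFractions f) (hinj : Function.Injective f) :
    Nonempty (OreSet (nonZeroDivisors A)) := by
  refine nonempty_oreSet_iff.2 ⟨fun r₁ r₂ s h => ⟨1, ?_⟩, fun r s => ?_⟩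
  · rw [(mul_cancel_right_mem_nonZeroDivisors s.2).1 h]
  · obtain ⟨u, v, hu, huv⟩ :=
      hf.exists_mul_eq_mul r ((hf.isUnit_map_iff_mem_nonZeroDivisors hinj).2 s.2)
    exact ⟨v, ⟨u, (hf.isUnit_map_iff_mem_nonZeroDivisors hinj).1 hu⟩, hinj huv⟩

theorem HasLeftFractions.isLeftClassicalQuotient (hf : HasLeftFractions f)
    (hinj : Function.Injective f) : IsLeftClassicalQuotient f := by
  obtain ⟨_⟩ := hf.nonempty_oreSet hinj
  have hunit : ∀ c, IsUnit (f c) ↔ c ∈ nonZeroDivisors A := fun _ =>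
    hf.isUnit_map_iff_mem_nonZeroDivisors hinj
  let g : nonZeroDivisors A →* Qˣ :=
    IsUnit.liftRight ((f : A →* Q).comp (nonZeroDivisors A).subtype) fun c => (hunit c).2 c.2
  have hg : ∀ s : nonZeroDivisors A, f s = g s := fun _ => rfl
  have hbij : Function.Bijective (universalHom f g hg) :=
    universalHom_bijective hg hinj fun q => by
      obtain ⟨s, r, hs, hr⟩ := hf q
      exact ⟨⟨s, (hunit s).1 hs⟩, r, hr⟩
  exact ⟨inferInstance, RingEquiv.ofBijective _ hbij, fun _ => universalHom_commutes f g hg⟩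

end ClassicalQuotient

/-! ### Goldie conditions -/

section UniformDimension

theorem card_le_length_of_iSupIndep {A M ι : Type*} [Ring A] [AddCommGroup M] [Module A M]
    [Fintype ι] {N : ι → Submodule A M} (hN : iSupIndep N) (hne : ∀ i, N i ≠ ⊥) :
    (Fintype.card ι : ℕ∞) ≤ Module.length A M := by
  classical
  have hpos : ∀ i, 1 ≤ Module.length A (N i) := fun i => by
    have := (Submodule.nontrivial_iff_ne_bot (p := N i)).2 (hne i)
    exact Order.one_le_iff_pos.2 Module.length_pos
  let e : (∀ i, N i) ≃ₗ[A] Π₀ i, N i := (DFinsupp.linearEquivFunOnFintype (R := A)).symm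
  let φ : (∀ i, N i) →ₗ[A] M := DFinsupp.lsum ℕ (fun i => (N i).subtype) ∘ₗ e.toLinearMap
  have hφ : Function.Injective φ := hN.dfinsupp_lsum_injective.comp e.injective
  calc (Fintype.card ι : ℕ∞) = ∑ _i : ι, 1 := by simp
    _ ≤ ∑ i, Module.length A (N i) := Finset.sum_le_sum fun i _ => hpos i
    _ = Module.length A (∀ i, N i) := (Module.length_pi_of_fintype A _).symm
    _ ≤ Module.length A M := Module.length_le_of_injective φ hφ

theorem leftUniformDim_le_length (A : Type*) [Ring A] : leftUniformDim A ≤ Module.length A A :=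
  iSup₂_le fun k ⟨_, hI, hne⟩ => by simpa using card_le_length_of_iSupIndep hI hne

variable {A Q : Type*} [Ring A] [Ring Q] {f : A →+* Q}

theorem HasLeftFractions.disjoint_map (hf : HasLeftFractions f) (hinj : Function.Injective f)
    {I J : Ideal A} (hIJ : Disjoint I J) : Disjoint (I.map f) (J.map f) := by
  refine Submodule.disjoint_def.2 fun q hqI hqJ => ?_
  obtain ⟨s, a, ha, hs, hsa⟩ := hf.exists_mul_eq_of_mem_map hqI
  obtain ⟨t, b, hb, ht, htb⟩ := hf.exists_mul_eq_of_mem_map hqJ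
  obtain ⟨u, v, hu, huv⟩ := hf.exists_mul_eq_mul s ht
  have hab : u * a = v * b := hinj <| by
    rw [map_mul, ← hsa, ← mul_assoc, ← map_mul, huv, map_mul, mul_assoc, htb, map_mul]
  have hua : u * a = 0 :=
    Submodule.disjoint_def.1 hIJ _ (I.mul_mem_left u ha) (hab ▸ J.mul_mem_left v hb)
  have hfa : f a = 0 := hu.mul_right_eq_zero.1 (by rw [← map_mul, hua, map_zero])
  exact hs.mul_right_eq_zero.1 (hsa.trans hfa)

theorem HasLeftFractions.iSupIndep_map (hf : HasLeftFractions f) (hinj : Function.Injective f)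
    {ι : Type*} {I : ι → Ideal A} (hI : iSupIndep I) : iSupIndep fun i => (I i).map f := fun i => by
  simpa only [Ideal.map_iSup] using hf.disjoint_map hinj (hI i)

theorem HasLeftFractions.leftUniformDim_le (hf : HasLeftFractions f)
    (hinj : Function.Injective f) : leftUniformDim A ≤ leftUniformDim Q :=
  iSup₂_mono' fun k ⟨I, hI, hne⟩ => ⟨k, ⟨fun i => (I i).map f, hf.iSupIndep_map hinj hI,
    fun i => (Ideal.map_eq_bot_iff_of_injective hinj).not.2 (hne i)⟩, le_rfl⟩

end UniformDimension

section Annihilators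

variable {A Q : Type*} [Ring A] [Ring Q]

/-- The left annihilator `leftAnn X` as a left ideal. -/
def leftAnnIdeal (X : Set A) : Ideal A := ⨅ x ∈ X, Ideal.torsionOf A A x

@[simp]
theorem coe_leftAnnIdeal (X : Set A) : (leftAnnIdeal X : Set A) = leftAnn X := by
  ext a
  simp [leftAnnIdeal, leftAnn]

theorem leftAnn_anti {X Y : Set A} (h : X ⊆ Y) : leftAnn Y ⊆ leftAnn X := fun _ ha x hx =>
  ha x (h hx)

/-- The right annihilator of a subset `X`. -/
def rightAnn (X : Set A) : Set A := {b | ∀ x ∈ X, x * b = 0}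

theorem rightAnn_anti {X Y : Set A} (h : X ⊆ Y) : rightAnn Y ⊆ rightAnn X := fun _ hb x hx =>
  hb x (h hx)

theorem leftAnn_rightAnn_leftAnn (X : Set A) : leftAnn (rightAnn (leftAnn X)) = leftAnn X :=
  Set.Subset.antisymm (leftAnn_anti fun x hx _ ha => ha x hx) fun a ha _ hb => hb a ha

theorem preimage_leftAnn_image {f : A →+* Q} (hinj : Function.Injective f) (X : Set A) :
    f ⁻¹' leftAnn (f '' X) = leftAnn X := by
  ext a
  simp [leftAnn, ← map_mul, map_eq_zero_iff f hinj]

theorem exists_forall_leftAnn_eq [IsNoetherianRing Q] {f : A →+* Q} (hinj : Function.Injective f)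
    {X : ℕ → Set A} (hX : Monotone fun n => leftAnn (X n)) :
    ∃ n, ∀ m, n ≤ m → leftAnn (X m) = leftAnn (X n) := by
  -- Passing to `rightAnn (leftAnn (X n))` makes the sets themselves decreasing, so that the
  -- annihilators of their images in `Q` increase.
  let Y : ℕ → Set A := fun n => rightAnn (leftAnn (X n))
  let L : ℕ →o Ideal Q :=
    { toFun := fun n => leftAnnIdeal (f '' Y n)
      monotone' := fun m n hmn => by
        simpa only [← SetLike.coe_subset_coe, coe_leftAnnIdeal] using
          leftAnn_anti (Set.image_mono (rightAnn_anti (hX hmn))) }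
  have hL : ∀ n, leftAnn (X n) = f ⁻¹' L n := fun n => by
    change leftAnn (X n) = f ⁻¹' (leftAnnIdeal (f '' Y n) : Set Q)
    rw [coe_leftAnnIdeal, preimage_leftAnn_image hinj, leftAnn_rightAnn_leftAnn]
  obtain ⟨n, hn⟩ := monotone_stabilizes_iff_noetherian.2 ‹IsNoetherianRing Q› L
  exact ⟨n, fun m hm => by rw [hL, hL, hn m hm]⟩

end Annihilators

theorem HasLeftFractions.isLeftGoldie {A Q : Type*} [Ring A] [Ring Q] [IsArtinianRing Q]
    {f : A →+* Q} (hf : HasLeftFractions f) (hinj : Function.Injective f) : IsLeftGoldie A :=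
  ⟨((hf.leftUniformDim_le hinj).trans (leftUniformDim_le_length Q)).trans_lt
    (lt_top_iff_ne_top.2 Module.length_ne_top), fun _ => exists_forall_leftAnn_eq hinj⟩

/-! ### Rings of left, right, or two-sided fractions -/

/-- Every element of `Q` is a right fraction `f(r) f(s)⁻¹`; see `hasRightFractions_iff`. As with
`IsRightClassicalQuotient`, right fractions are left fractions over the opposite rings. -/
def HasRightFractions {R Q : Type*} [Semiring R] [Semiring Q] (f : R →+* Q) : Prop :=
  HasLeftFractions (RingHom.op f)

theorem hasRightFractions_iff {R Q : Type*} [Semiring R] [Semiring Q] {f : R →+* Q} :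
    HasRightFractions f ↔ ∀ q : Q, ∃ r s : R, IsUnit (f s) ∧ q * f s = f r := by
  refine ⟨fun h q => ?_, fun h q => ?_⟩
  · obtain ⟨s, r, hs, hr⟩ := h (.op q)
    exact ⟨r.unop, s.unop, hs.unop, congrArg MulOpposite.unop hr⟩
  · obtain ⟨r, s, hs, hr⟩ := h q.unop
    exact ⟨.op s, .op r, hs.op, MulOpposite.unop_injective hr⟩

/-- The elements of `Q` are `*` fractions of elements of `R`, for `* ∈ {l, r, ∅}`. -/
def HasFractions {R Q : Type*} [Semiring R] [Semiring Q] : Side → (R →+* Q) → Prop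
  | .left, f => HasLeftFractions f
  | .right, f => HasRightFractions f
  | .both, f => HasLeftFractions f ∧ HasRightFractions f

theorem op_injective {R Q : Type*} [NonAssocSemiring R] [NonAssocSemiring Q] {f : R →+* Q}
    (hinj : Function.Injective f) : Function.Injective (RingHom.op f) :=
  MulOpposite.op_injective.comp (hinj.comp MulOpposite.unop_injective)

namespace HasFractions

section Semiring

variable {R Q : Type*} [Semiring R] [Semiring Q] {f : R →+* Q} {side : Side}

theorem left_or_right (hf : HasFractions side f) : HasLeftFractions f ∨ HasRightFractions f :=
  match side, hf with
  | .left, hf => .inl hf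
  | .right, hf => .inr hf
  | .both, hf => .inl hf.1

theorem of_comp {A : Type*} [Semiring A] {g : A →+* Q} {h : R →+* A}
    (hgh : HasFractions side (g.comp h)) : HasFractions side g :=
  match side, hgh with
  | .left, hgh => HasLeftFractions.of_comp hgh
  | .right, hgh => HasLeftFractions.of_comp (h := RingHom.op h) hgh
  | .both, hgh => ⟨hgh.1.of_comp, HasLeftFractions.of_comp (h := RingHom.op h) hgh.2⟩

theorem ringEquiv_comp (hf : HasFractions side f) {Q' : Type*} [Semiring Q'] (e : Q ≃+* Q') :
    HasFractions side ((e : Q →+* Q').comp f) :=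
  match side, hf with
  | .left, hf => HasLeftFractions.ringEquiv_comp hf e
  | .right, hf => HasLeftFractions.ringEquiv_comp hf (RingEquiv.op e)
  | .both, hf => ⟨hf.1.ringEquiv_comp e, HasLeftFractions.ringEquiv_comp hf.2 (RingEquiv.op e)⟩

end Semiring

variable {R Q : Type*} [Ring R] [Ring Q] {f : R →+* Q} {side : Side}

theorem isUnit_map_iff_mem_nonZeroDivisors [IsSemisimpleRing Q] (hf : HasFractions side f)
    (hinj : Function.Injective f) {c : R} : IsUnit (f c) ↔ c ∈ nonZeroDivisors R := by
  rcases hf.left_or_right with hf | hf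
  · exact hf.isUnit_map_iff_mem_nonZeroDivisors hinj
  · have h := HasLeftFractions.isUnit_map_iff_mem_nonZeroDivisors hf (op_injective hinj)
      (c := .op c)
    rw [← isRegular_iff_mem_nonZeroDivisors, isRegular_op, isRegular_iff_mem_nonZeroDivisors] at h
    exact isUnit_op.symm.trans h

theorem isGoldie [IsSemisimpleRing Q] (hf : HasFractions side f) (hinj : Function.Injective f) :
    IsGoldie side R :=
  match side, hf with
  | .left, hf => HasLeftFractions.isLeftGoldie hf hinj
  | .right, hf => HasLeftFractions.isLeftGoldie hf (op_injective hinj)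
  | .both, hf => ⟨hf.1.isLeftGoldie hinj, HasLeftFractions.isLeftGoldie hf.2 (op_injective hinj)⟩

theorem isClassicalQuotient [IsSemisimpleRing Q] (hf : HasFractions side f)
    (hinj : Function.Injective f) : IsClassicalQuotient side R Q f :=
  match side, hf with
  | .left, hf => HasLeftFractions.isLeftClassicalQuotient hf hinj
  | .right, hf => HasLeftFractions.isLeftClassicalQuotient hf (op_injective hinj)
  | .both, hf => ⟨hf.1.isLeftClassicalQuotient hinj,
      HasLeftFractions.isLeftClassicalQuotient hf.2 (op_injective hinj)⟩

section Simple

variable [IsSimpleRing Q] [IsArtinianRing Q]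

theorem exists_mem_isUnit_map (hf : HasFractions side f) {I : TwoSidedIdeal R}
    (hI : ¬ I ≤ TwoSidedIdeal.ker f) : ∃ d ∈ I, IsUnit (f d) := by
  rcases hf.left_or_right with hf | hf
  · exact hf.exists_mem_isUnit_map hI
  · have hIop : ¬ I.op ≤ TwoSidedIdeal.ker (RingHom.op f) := fun h => hI fun x hx =>
      (TwoSidedIdeal.mem_ker f).2 (MulOpposite.op_injective
        ((TwoSidedIdeal.mem_ker _).1 (h (TwoSidedIdeal.mem_op_iff.2 hx))))
    obtain ⟨d, hd, hu⟩ := HasLeftFractions.exists_mem_isUnit_map hf hIop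
    exact ⟨d.unop, TwoSidedIdeal.mem_op_iff.1 hd, hu.unop⟩

theorem isPrimeIdeal_ker (hf : HasFractions side f) : IsPrimeIdeal (TwoSidedIdeal.ker f) := by
  refine ⟨fun h => ?_, fun I J hIJ => ?_⟩
  · have h1 := (TwoSidedIdeal.mem_ker f).1 ((TwoSidedIdeal.one_mem_iff _).2 h)
    exact one_ne_zero ((map_one f).symm.trans h1)
  · by_contra! h
    obtain ⟨d, hd, hfd⟩ := hf.exists_mem_isUnit_map h.1
    obtain ⟨e, he, hfe⟩ := hf.exists_mem_isUnit_map h.2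
    have hde : f (d * e) = 0 := (TwoSidedIdeal.mem_ker f).1 (hIJ d hd e he)
    rw [map_mul] at hde
    exact (hfd.mul hfe).ne_zero hde

theorem isPrimeRing (hf : HasFractions side f) (hinj : Function.Injective f) : IsPrimeRing R := by
  rw [IsPrimeRing, ← (TwoSidedIdeal.ker_eq_bot f).2 hinj]
  exact hf.isPrimeIdeal_ker

end Simple

end HasFractions

/-! ### Irredundant intersections -/

theorem not_iInf_ne_le_of_irredundant {α ι : Type*} [CompleteLattice α] {p : ι → α}
    (hinter : ⨅ i, p i = ⊥) {i : ι} (hirr : ⨅ (j) (_ : j ≠ i), p j ≠ ⊥) :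
    ¬ ⨅ (j) (_ : j ≠ i), p j ≤ p i := fun h =>
  hirr (by rw [← hinter, iInf_split_single p i, inf_eq_right.2 h])

section MinimalPrimes

variable {R : Type*} [Ring R]

theorem IsPrimeIdeal.infPrime {P : TwoSidedIdeal R} (hP : IsPrimeIdeal P) : InfPrime P :=
  ⟨fun h => hP.1 h.eq_top, fun I J hIJ => hP.2 I J fun _ ha _ hb =>
    hIJ ((TwoSidedIdeal.mem_inf R).2 ⟨I.mul_mem_right _ _ ha, J.mul_mem_left _ _ hb⟩)⟩

theorem IsPrimeIdeal.exists_le_of_iInf_le {ι : Type*} [Finite ι] {p : ι → TwoSidedIdeal R}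
    {P : TwoSidedIdeal R} (hP : IsPrimeIdeal P) (h : ⨅ i, p i ≤ P) : ∃ i, p i ≤ P := by
  cases nonempty_fintype ι
  rw [← Finset.inf_univ_eq_iInf] at h
  obtain ⟨i, -, hi⟩ := hP.infPrime.finset_inf_le.1 h
  exact ⟨i, hi⟩

theorem minPrimes_eq_range {ι : Type*} [Finite ι] {p : ι → TwoSidedIdeal R}
    (hp : ∀ i, IsPrimeIdeal (p i)) (hinter : ⨅ i, p i = ⊥)
    (hirr : ∀ i, ⨅ (j) (_ : j ≠ i), p j ≠ ⊥) : minPrimes R = Set.range p := by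
  have hexists : ∀ P, IsPrimeIdeal P → ∃ i, p i ≤ P := fun P hP =>
    hP.exists_le_of_iInf_le (hinter.trans_le bot_le)
  have hincomparable : ∀ i j, p j ≤ p i → j = i := fun i j hji => by
    by_contra hne
    exact not_iInf_ne_le_of_irredundant hinter (hirr i) ((iInf₂_le j hne).trans hji)
  refine Set.Subset.antisymm (fun P hP => ?_) ?_
  · obtain ⟨i, hi⟩ := hexists P hP.1
    exact ⟨i, hi.antisymm (hP.2 (hp i) hi)⟩
  · rintro _ ⟨i, rfl⟩
    refine ⟨hp i, fun P hP hle => ?_⟩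
    obtain ⟨j, hj⟩ := hexists P hP
    rwa [hincomparable i j (hj.trans hle)] at hj

end MinimalPrimes

section Product

variable {R ι : Type*} [Ring R] {Q : ι → Type*} [∀ i, Ring (Q i)] {f : ∀ i, R →+* Q i}
  {side : Side}

theorem ker_pi (f : ∀ i, R →+* Q i) :
    TwoSidedIdeal.ker (RingHom.pi f) = ⨅ i, TwoSidedIdeal.ker (f i) := by
  ext x
  simp [TwoSidedIdeal.mem_iInf, TwoSidedIdeal.mem_ker, funext_iff]

theorem HasLeftFractions.pi [Finite ι] (hf : ∀ i, HasLeftFractions (f i))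
    (hd : ∀ i, ∃ d, IsUnit (f i d) ∧ ∀ j, j ≠ i → f j d = 0) :
    HasLeftFractions (RingHom.pi f) := by
  intro q
  cases nonempty_fintype ι
  choose d hunit hzero using hd
  choose s r hs hr using fun i => hf i (q i)
  have hsum : ∀ (a : ι → R) (i : ι), f i (∑ j, d j * a j) = f i (d i) * f i (a i) := by
    intro a i
    rw [map_sum, Finset.sum_eq_single_of_mem i (Finset.mem_univ i), map_mul]
    intro j _ hj
    rw [map_mul, hzero j i hj.symm, zero_mul]
  refine ⟨∑ j, d j * s j, ∑ j, d j * r j, Pi.isUnit_iff.2 fun i => ?_, funext fun i => ?_⟩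
  · simpa only [RingHom.pi_apply, hsum] using (hunit i).mul (hs i)
  · simp only [Pi.mul_apply, RingHom.pi_apply, hsum, mul_assoc, hr]

theorem HasRightFractions.pi [Finite ι] (hf : ∀ i, HasRightFractions (f i))
    (hd : ∀ i, ∃ d, IsUnit (f i d) ∧ ∀ j, j ≠ i → f j d = 0) :
    HasRightFractions (RingHom.pi f) := by
  have hop := HasLeftFractions.pi hf fun i => by
    obtain ⟨d, hunit, hzero⟩ := hd i
    exact ⟨.op d, hunit.op, fun j hj => congrArg MulOpposite.op (hzero j hj)⟩
  refine hasRightFractions_iff.2 fun q => ?_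
  obtain ⟨s, r, hs, hr⟩ := hop fun i => .op (q i)
  exact ⟨r.unop, s.unop, Pi.isUnit_iff.2 fun i => (Pi.isUnit_iff.1 hs i).unop,
    funext fun i => congrArg MulOpposite.unop (congrFun hr i)⟩

theorem HasFractions.pi [Finite ι] (hf : ∀ i, HasFractions side (f i))
    (hd : ∀ i, ∃ d, IsUnit (f i d) ∧ ∀ j, j ≠ i → f j d = 0) :
    HasFractions side (RingHom.pi f) :=
  match side, hf with
  | .left, hf => HasLeftFractions.pi hf hd
  | .right, hf => HasRightFractions.pi hf hd
  | .both, hf => ⟨HasLeftFractions.pi (fun i => (hf i).1) hd,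
      HasRightFractions.pi (fun i => (hf i).2) hd⟩

theorem isClassicalQuotient_pi [Finite ι] [∀ i, IsSimpleRing (Q i)] [∀ i, IsArtinianRing (Q i)]
    (hf : ∀ i, HasFractions side (f i)) (hinter : ⨅ i, TwoSidedIdeal.ker (f i) = ⊥)
    (hirr : ∀ i, ⨅ (j) (_ : j ≠ i), TwoSidedIdeal.ker (f j) ≠ ⊥) :
    IsClassicalQuotient side R (∀ i, Q i) (RingHom.pi f) := by
  have hinj : Function.Injective (RingHom.pi f) :=
    (TwoSidedIdeal.ker_eq_bot _).1 ((ker_pi f).trans hinter)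
  have hd : ∀ i, ∃ d, IsUnit (f i d) ∧ ∀ j, j ≠ i → f j d = 0 := fun i => by
    obtain ⟨d, hmem, hunit⟩ :=
      (hf i).exists_mem_isUnit_map (not_iInf_ne_le_of_irredundant hinter (hirr i))
    have hle : ∀ j, j ≠ i →
        ⨅ (k) (_ : k ≠ i), TwoSidedIdeal.ker (f k) ≤ TwoSidedIdeal.ker (f j) := iInf₂_le
    exact ⟨d, hunit, fun j hj => (TwoSidedIdeal.mem_ker _).1 (hle j hj hmem)⟩
  exact (HasFractions.pi hf hd).isClassicalQuotient hinj

end Product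

/-! ### Localizable sets -/

section Localizable

variable {R : Type*} [Ring R] {S : Submonoid R} {side : Side}

theorem IsLeftLocalizable.hasLeftFractions (hS : IsLeftLocalizable S) :
    HasLeftFractions (toLoc S) := fun q => by
  obtain ⟨s, r, rfl⟩ := hS.exists_fraction q
  exact ⟨s, r, isUnit_toLoc s.2, by rw [← mul_assoc, toLoc_mul_locInv, one_mul]⟩

theorem IsRightLocalizable.hasRightFractions (hS : IsRightLocalizable S) :
    HasRightFractions (toLoc S) := hasRightFractions_iff.2 fun q => by
  obtain ⟨r, s, rfl⟩ := hS.exists_fraction q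
  exact ⟨r, s, isUnit_toLoc s.2, by rw [mul_assoc, locInv_mul_toLoc, mul_one]⟩

theorem IsLocalizable.hasFractions (hS : IsLocalizable side S) : HasFractions side (toLoc S) :=
  match side, hS with
  | .left, hS => IsLeftLocalizable.hasLeftFractions hS
  | .right, hS => IsRightLocalizable.hasRightFractions hS
  | .both, hS => ⟨hS.1.hasLeftFractions, hS.2.hasRightFractions⟩

theorem IsLocalizable.nontrivial (hS : IsLocalizable side S) : Nontrivial (Loc S) :=
  match side, hS with
  | .left, hS => IsLeftLocalizable.nontrivial hS
  | .right, hS => IsRightLocalizable.nontrivial hS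
  | .both, hS => hS.1.nontrivial

theorem zero_notMem_of_nontrivial [Nontrivial (Loc S)] : (0 : R) ∉ S := fun h =>
  (isUnit_toLoc h).ne_zero (map_zero _)

theorem HasLeftFractions.isLeftLocalizable [Nontrivial (Loc S)] (hf : HasLeftFractions (toLoc S))
    (hS : saturation S ≤ S) : IsLeftLocalizable S where
  zero_notMem := zero_notMem_of_nontrivial
  nontrivial := inferInstance
  exists_fraction q := by
    obtain ⟨s, r, hs, hr⟩ := hf q
    refine ⟨⟨s, hS hs⟩, r, ?_⟩
    rw [← hr, ← mul_assoc, locInv_mul_toLoc (⟨s, hS hs⟩ : S), one_mul]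

theorem HasRightFractions.isRightLocalizable [Nontrivial (Loc S)]
    (hf : HasRightFractions (toLoc S)) (hS : saturation S ≤ S) : IsRightLocalizable S where
  zero_notMem := zero_notMem_of_nontrivial
  nontrivial := inferInstance
  exists_fraction q := by
    obtain ⟨r, s, hs, hr⟩ := hasRightFractions_iff.1 hf q
    refine ⟨r, ⟨s, hS hs⟩, ?_⟩
    rw [← hr, mul_assoc, toLoc_mul_locInv (⟨s, hS hs⟩ : S), mul_one]

theorem HasFractions.isLocalizable [Nontrivial (Loc S)] (hf : HasFractions side (toLoc S))
    (hS : saturation S ≤ S) : IsLocalizable side S :=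
  match side, hf with
  | .left, hf => HasLeftFractions.isLeftLocalizable hf hS
  | .right, hf => HasRightFractions.isRightLocalizable hf hS
  | .both, hf => ⟨hf.1.isLeftLocalizable hS, hf.2.isRightLocalizable hS⟩

theorem saturation_saturation_le : saturation (saturation S) ≤ saturation S := fun r hr => by
  rw [mem_saturation, ← locEquivSaturation_toLoc] at hr
  exact (MulEquiv.isUnit_map (locEquivSaturation S)).1 hr

theorem isLocalizable_saturation (hS : IsLocalizable side S) :
    IsLocalizable side (saturation S) := by
  have hcomp : RingHom.comp (locEquivSaturation S : Loc S →+* Loc (saturation S)) (toLoc S) =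
      toLoc (saturation S) := RingHom.ext fun r => locEquivSaturation_toLoc r
  have := hS.nontrivial
  have := (locEquivSaturation S).symm.toEquiv.nontrivial
  exact (hcomp ▸ hS.hasFractions.ringEquiv_comp (locEquivSaturation S)).isLocalizable
    saturation_saturation_le

theorem IsLocalizable.maximal_saturation [IsSimpleRing (Loc S)] [IsArtinianRing (Loc S)]
    (hS : IsLocalizable side S) : Maximal (IsLocalizable side) (saturation S) :=
  ⟨isLocalizable_saturation hS, fun _ hT hle =>
    have := hT.nontrivial
    le_saturation_of_le (le_saturation.trans hle)⟩

theorem hasFractions_assQuotToLoc (hf : HasFractions side (toLoc S)) :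
    HasFractions side (assQuotToLoc S) :=
  HasFractions.of_comp (Q := Loc S) (h := (ass S).ringCon.mk') hf

theorem HasFractions.regularModulo_ass [IsSemisimpleRing (Loc S)]
    (hf : HasFractions side (toLoc S)) : regularModulo (ass S) = saturation S :=
  Submonoid.ext fun _ => (isUnit_map_iff_mem_nonZeroDivisors (Q := Loc S)
    (hasFractions_assQuotToLoc hf) assQuotToLoc_injective).symm

end Localizable

end LocalizableSets

open LocalizableSets in
theorem mainTheorem3 {R : Type u} [Ring R] (side : Side) (n : ℕ) (S : Fin n → Submonoid R)
    (hS : ∀ i, IsLocalizable side (S i))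
    (hsimple : ∀ i, IsSimpleRing (Loc (S i)))
    (hartinian : ∀ i, IsArtinianRing (Loc (S i)))
    (hinter : (⨅ i, ass (S i)) = ⊥)
    (hirredundant : ∀ i, (⨅ (j : Fin n) (_ : j ≠ i), ass (S j)) ≠ ⊥) :
    (∀ i, IsPrimeRing (ass (S i)).ringCon.Quotient ∧
      IsGoldie side (ass (S i)).ringCon.Quotient) ∧
    minPrimes R = Set.range (fun i => ass (S i)) ∧
    (∀ i, IsClassicalQuotient side (ass (S i)).ringCon.Quotient (Loc (S i)) (assQuotToLoc (S i))) ∧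
    (∀ i, S i ≤ regularModulo (ass (S i))) ∧
    IsClassicalQuotient side R (∀ i, Loc (S i)) (RingHom.pi fun i => toLoc (S i)) ∧
    (∀ i, Maximal (IsLocalizable side) (regularModulo (ass (S i)))) := by
  have hfrac i := (hS i).hasFractions
  have hfracQuot i := hasFractions_assQuotToLoc (hfrac i)
  have hregular i : regularModulo (ass (S i)) = saturation (S i) := (hfrac i).regularModulo_ass
  refine ⟨fun i => ⟨?prime, ?goldie⟩, ?minimalPrimes, fun i => ?quotient, fun i => ?le,
    ?productQuotient, fun i => ?maximal⟩
  case prime => exact HasFractions.isPrimeRing (Q := Loc (S i)) (hfracQuot i) assQuotToLoc_injective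
  case goldie => exact HasFractions.isGoldie (Q := Loc (S i)) (hfracQuot i) assQuotToLoc_injective
  case minimalPrimes =>
    have hprime i := HasFractions.isPrimeIdeal_ker (Q := Loc (S i)) (hfrac i)
    exact minPrimes_eq_range hprime hinter hirredundant
  case quotient => exact (hfracQuot i).isClassicalQuotient assQuotToLoc_injective
  case le => exact (hregular i).symm ▸ le_saturation
  case productQuotient => exact isClassicalQuotient_pi hfrac hinter hirredundant
  case maximal => exact (hregular i).symm ▸ (hS i).maximal_saturation
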